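/- Let $\zeta(3)=\sum_{m\ge1}1/m^3$ and, for each integer $n\ge0$, let $D_n$ be the least common multiple of $1,2,\dots,n$ (with $D_0=1$), $$R_n(t)=\left(\frac{(t-1)\cdots(t-n)}{t(t+1)\cdots(t+n)}\right)^2,\qquad F_n=-\sum_{t=1}^\infty R_n'(t),$$ $$\widetilde R_n(t)=n!^2(2t+n)\,\frac{(t-1)\cdots(t-n)\cdot(t+n+1)\cdots(t+2n)}{\bigl(t(t+1)\cdots(t+n)\bigr)^4},\qquad \widetilde F_n=\sum_{t=1}^\infty\widetilde R_n(t).$$ Then (Apéry's theorem) the number $\zeta(3)$ is irrational. Moreover: (i) for every $n\ge0$ the series $F_n$ converges absolutely, and $F_n=u_n\zeta(3)-v_n$ with an integer $u_n$ and a rational number $v_n$ such that $D_n^3v_n$ is an integer; (ii) for every $n\ge0$ the series $\widetilde F_n$ converges absolutely, and $F_n=\widetilde F_n$; (iii) for every $n\ge0$ one has $0<\widetilde F_n<20(n+1)^4(\sqrt2-1)^{4n}$; (iv) $D_n<3^n$ for every $n\ge1$. -/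

import Mathlib

namespace AperyZetaThree

noncomputable section

/-- The real number `ζ(3) = ∑_{n ≥ 1} 1 / n ^ 3`. -/
def zeta3 : ℝ := ∑' n : ℕ, 1 / ((n : ℝ) + 1) ^ 3

/-- `zeta3` is the value at `3` of Mathlib's Riemann zeta function. -/
theorem coe_zeta3 : ((zeta3 : ℝ) : ℂ) = riemannZeta 3 := by
  have h := zeta_eq_tsum_one_div_nat_add_one_cpow (s := 3) (by norm_num)
  rw [h, zeta3, Complex.ofReal_tsum]
  refine tsum_congr fun n => ?_
  have : ((n : ℂ) + 1) ^ (3 : ℂ) = ((n : ℂ) + 1) ^ 3 := by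
    exact_mod_cast Complex.cpow_natCast ((n : ℂ) + 1) 3
  rw [this]
  push_cast
  rfl

/-- `D n` is the least common multiple of `1, 2, …, n`, with `D 0 = 1`. -/
def D (n : ℕ) : ℕ := (Finset.Icc 1 n).lcm id

/-- `R n t = ((t - 1) ⋯ (t - n) / (t (t + 1) ⋯ (t + n))) ^ 2`. -/
def R (n : ℕ) (t : ℝ) : ℝ :=
  ((∏ j ∈ Finset.Icc 1 n, (t - j)) / ∏ j ∈ Finset.range (n + 1), (t + j)) ^ 2

/-- `F n = - ∑_{t ≥ 1} R_n'(t)`. -/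
def F (n : ℕ) : ℝ := -∑' t : ℕ, deriv (R n) ((t : ℝ) + 1)

/-- Ball's rational function
`n! ^ 2 (2 t + n) (t - 1) ⋯ (t - n) (t + n + 1) ⋯ (t + 2 n) / (t (t + 1) ⋯ (t + n)) ^ 4`. -/
def ballR (n : ℕ) (t : ℝ) : ℝ :=
  (n.factorial : ℝ) ^ 2 * (2 * t + n) *
    ((∏ j ∈ Finset.Icc 1 n, (t - j)) * ∏ j ∈ Finset.Icc 1 n, (t + n + j)) /
      (∏ j ∈ Finset.range (n + 1), (t + j)) ^ 4

/-- Ball's series `∑_{t ≥ 1} ballR n t`. -/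
def ballF (n : ℕ) : ℝ := ∑' t : ℕ, ballR n ((t : ℝ) + 1)

end

end AperyZetaThree

namespace AperyZetaThree

open Finset Nat Filter Topology

/-! Two descriptions of one sequence are played against each other. Partial fractions turn `F n`
into a linear form in 1 and `ζ(3)` whose denominator divides `D n ^ 3`, but say little about its
size. Ball's series `ballF n` has nonnegative terms, dominated by `3 / t ^ 3` uniformly in `n`, so
it is positive and bounded. Creative telescoping shows that both satisfy Apéry's second-order
recurrence, and they agree at `n = 0, 1`; hence `F_eq_ballF`.

The decay needs no asymptotic analysis of the series. Put `a = (√2 - 1) ^ 4`, the smaller root of `x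
^ 2 - 34 x + 1`. A positive solution with `X (n + 1) > a * X n` for some `n` would grow
exponentially, so a bounded one decays at least like `a ^ n` (`AperyRec.succ_le`).

Finally `D n < 3 ^ n` by a Hanson-type argument, and `27 a < 1`. If `ζ(3)` were rational with
denominator `q`, then `q * D n ^ 3 * F n` would be a positive integer tending to 0. -/

/-! ### The bound `D n < 3 ^ n`. -/

/-- The numbers 2, 3, 7, 43 begin Sylvester's sequence, and 1806 is their product: `1/2 + 1/3 + 1/7
+ 1/43 + 1/1806 = 1`. The quotient of factorials is thus almost a multinomial coefficient, and the
gap is paid for by the much smaller `D (n / 1806)`. -/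
theorem D_mul_prod_factorial_dvd (n : ℕ) :
    D n * ((n / 2)! * (n / 3)! * (n / 7)! * (n / 43)! * (n / 1806)!) ∣ n ! * D (n / 1806) := by
  have hD : ∀ m, D m ≠ 0 := Nat.lcmUpto_ne_zero
  have hf : ∀ m : ℕ, m ! ≠ 0 := Nat.factorial_ne_zero
  have hlog : ∀ {p : ℕ}, p.Prime → ∀ {m b : ℕ}, Nat.log p m < b →
      (D m).factorization p = ∑ i ∈ Ico 1 b, if 1 ≤ m / p ^ i then 1 else 0 := by
    intro p hp m b hb
    rw [show D m = Nat.lcmUpto m from rfl, Nat.factorization_lcmUpto m hp,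
      ← Finset.card_filter]
    have : (Ico 1 b).filter (fun i => 1 ≤ m / p ^ i) = Icc 1 (Nat.log p m) := by
      ext i
      simp only [mem_filter, mem_Ico, mem_Icc]
      have h1 : 1 ≤ m / p ^ i ↔ p ^ i ≤ m := by
        rw [Nat.le_div_iff_mul_le (pow_pos hp.pos i), one_mul]
      rw [h1]
      constructor
      · rintro ⟨⟨h, -⟩, h'⟩
        exact ⟨h, Nat.le_log_of_pow_le hp.one_lt h'⟩
      · rintro ⟨h, h'⟩
        refine ⟨⟨h, by omega⟩, ?_⟩
        exact Nat.pow_le_of_le_log (by rintro rfl; simp at h'; omega) h'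
    rw [this]; simp
  rw [← Nat.factorization_prime_le_iff_dvd (by simp [hD, hf]) (by simp [hD, hf])]
  intro p hp
  have hb : ∀ a, Nat.log p (n / a) < Nat.log p n + 1 := fun a =>
    Nat.lt_succ_of_le (Nat.log_mono_right (Nat.div_le_self n a))
  have hb1 := Nat.lt_succ_self (Nat.log p n)
  rw [Nat.factorization_mul (hD _) (by simp [hf]), Nat.factorization_mul (by simp [hf]) (hf _),
    Nat.factorization_mul (by simp [hf]) (hf _), Nat.factorization_mul (by simp [hf]) (hf _),
    Nat.factorization_mul (hf _) (hf _), Nat.factorization_mul (hf _) (hD _)]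
  simp only [Finsupp.add_apply]
  rw [Nat.factorization_factorial hp (hb 2), Nat.factorization_factorial hp (hb 3),
    Nat.factorization_factorial hp (hb 7), Nat.factorization_factorial hp (hb 43),
    Nat.factorization_factorial hp (hb 1806), Nat.factorization_factorial hp hb1,
    hlog hp hb1, hlog hp (hb 1806)]
  simp only [← Finset.sum_add_distrib]
  refine Finset.sum_le_sum fun i _ => ?_
  have h : ∀ a, n / a / p ^ i = n / p ^ i / a := fun a => by
    rw [Nat.div_div_eq_div_mul, Nat.div_div_eq_div_mul, Nat.mul_comm]
  simp only [h]
  -- The five floors sum to at most `m`. For `1 ≤ m < 1806` the last one is 0 and the others sum to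
  -- at most `m - m / 1806 < m`, which leaves room for the 1 from `D n`; for `m ≥ 1806` both
  -- indicators equal 1.
  generalize n / p ^ i = m
  split_ifs <;> omega

theorem log_factorial_le {n : ℕ} (hn : 1 ≤ n) :
    Real.log (n ! : ℝ) ≤ n * Real.log n - n + 1 + Real.log n := by
  induction n, hn using Nat.le_induction with
  | base => simp
  | succ n hn ih =>
    have hn0 : (0 : ℝ) < n := by exact_mod_cast hn
    have h1 : (0 : ℝ) < n + 1 := by positivity
    rw [Nat.factorial_succ, Nat.cast_mul, Real.log_mul (by positivity) (by positivity)]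
    push_cast
    have h2 := Real.one_sub_inv_le_log_of_pos (div_pos h1 hn0)
    rw [Real.log_div h1.ne' hn0.ne', inv_div] at h2
    have h3 : (n + 1 : ℝ) * (1 - n / (n + 1)) = 1 := by field_simp; ring
    nlinarith

theorem le_log_factorial (n : ℕ) : n * Real.log n - n ≤ Real.log (n ! : ℝ) := by
  induction n with
  | zero => simp
  | succ n ih =>
    rcases Nat.eq_zero_or_pos n with rfl | hn
    · simp
    have hn0 : (0 : ℝ) < n := by exact_mod_cast hn
    have h1 : (0 : ℝ) < n + 1 := by positivity
    rw [Nat.factorial_succ, Nat.cast_mul, Real.log_mul (by positivity) (by positivity)]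
    push_cast
    have h2 := Real.log_le_sub_one_of_pos (div_pos h1 hn0)
    rw [Real.log_div h1.ne' hn0.ne'] at h2
    have h3 : (n : ℝ) * ((n + 1) / n - 1) = 1 := by field_simp; ring
    nlinarith

/-- A lower bound for `log ⌊n / a⌋!` in terms of the real quotient `n / a`. -/
theorem le_log_factorial_div {n a : ℕ} (ha : 2 ≤ a) (hn : a ≤ n) :
    (n / a : ℝ) * (Real.log n - Real.log a) - n / a - Real.log n ≤ Real.log ((n / a)! : ℝ) := by
  have ha0 : (0 : ℝ) < a := by exact_mod_cast (by omega : 0 < a)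
  have hn0 : (0 : ℝ) < n := by exact_mod_cast (by omega : 0 < n)
  rw [← Real.log_div hn0.ne' ha0.ne']
  set m := n / a with hm
  set y : ℝ := n / a with hy
  have hy1 : 1 ≤ y := by rw [hy, le_div_iff₀ ha0, one_mul]; exact_mod_cast hn
  have hym : y ≤ m + 1 := by
    rw [hy, div_le_iff₀ ha0]
    exact_mod_cast (by rw [mul_comm]; exact (Nat.lt_mul_div_succ n (by omega)).le)
  have hmn : m + 1 ≤ n := by
    have : m ≤ n / 2 := Nat.div_le_div_left ha (by norm_num)
    omega
  have hm1 : (0 : ℝ) < m + 1 := by positivity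
  -- The bound is taken at `m + 1 ≥ y`, so that `x log x - x`, increasing for `x ≥ 1`, can be
  -- compared with its value at `y`; the factor `m + 1` costs one `log n`.
  have h1 := le_log_factorial (m + 1)
  rw [Nat.factorial_succ, Nat.cast_mul, Real.log_mul (by positivity) (by positivity)] at h1
  push_cast at h1
  have h2 : Real.log (m + 1 : ℝ) ≤ Real.log n := Real.log_le_log hm1 (by exact_mod_cast hmn)
  have hy0 : 0 < y := by linarith
  have h3 := Real.one_sub_inv_le_log_of_pos (div_pos hm1 hy0)
  rw [Real.log_div hm1.ne' hy0.ne', inv_div] at h3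
  have h4 : (m + 1 : ℝ) * (1 - y / (m + 1)) = m + 1 - y := by field_simp
  have h5 : 0 ≤ Real.log y := Real.log_nonneg hy1
  nlinarith [mul_le_mul_of_nonneg_left h3 hm1.le, mul_nonneg (sub_nonneg.2 hym) h5]

/-- This is the entropy of the partition `1/2, 1/3, 1/7, 1/43, 1/1806`, scaled by 1806. One of the
1806 copies of `log 3` is reserved for `D (n / 1806) ≤ 3 ^ (n / 1806)`; the spare `40 log 2` absorbs
the Stirling errors. -/
theorem log_gap : 40 * Real.log 2 + (903 * Real.log 2 + 602 * Real.log 3 + 258 * Real.log 7 +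
    42 * Real.log 43 + Real.log 1806) ≤ 1805 * Real.log 3 := by
  have h : (2 : ℝ) ^ 40 * (2 ^ 903 * 3 ^ 602 * 7 ^ 258 * 43 ^ 42 * 1806) ≤ 3 ^ 1805 := by
    have h' : 2 ^ 40 * (2 ^ 903 * 3 ^ 602 * 7 ^ 258 * 43 ^ 42 * 1806) ≤ 3 ^ 1805 := by
      decide +kernel
    exact_mod_cast h'
  have := Real.log_le_log (by positivity) h
  rw [Real.log_mul (by positivity) (by positivity), Real.log_mul (by positivity) (by positivity),
    Real.log_mul (by positivity) (by positivity), Real.log_mul (by positivity) (by positivity),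
    Real.log_mul (by positivity) (by positivity)] at this
  simp only [Real.log_pow] at this
  push_cast at this
  linarith

theorem D_lt_three_pow_of_large {n : ℕ} (hn : 4000 ≤ n) (ih : D (n / 1806) ≤ 3 ^ (n / 1806)) :
    D n < 3 ^ n := by
  have hD : ∀ m, 0 < D m := Nat.lcmUpto_pos
  have hDR : ∀ m, (0 : ℝ) < D m := fun m => by exact_mod_cast hD m
  have hf : ∀ m : ℕ, (0 : ℝ) < (m ! : ℝ) := fun m => by exact_mod_cast Nat.factorial_pos m
  have h1 : (D n : ℝ) * ((n / 2)! * (n / 3)! * (n / 7)! * (n / 43)! * (n / 1806)!) ≤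
      n ! * D (n / 1806) := by
    exact_mod_cast Nat.le_of_dvd (mul_pos (Nat.factorial_pos n) (hD _))
      (D_mul_prod_factorial_dvd n)
  have h2 := Real.log_le_log (by have := hDR n; have := hf; positivity) h1
  have hne : ∀ m : ℕ, (m ! : ℝ) ≠ 0 := fun m => (hf m).ne'
  have hDne : ∀ m : ℕ, (D m : ℝ) ≠ 0 := fun m => (hDR m).ne'
  rw [Real.log_mul (hDne _) (by simp [hne]), Real.log_mul (by simp [hne]) (hne _),
    Real.log_mul (by simp [hne]) (hne _), Real.log_mul (by simp [hne]) (hne _),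
    Real.log_mul (hne _) (hne _), Real.log_mul (hne _) (hDne _)] at h2
  have h3 := log_factorial_le (n := n) (by omega)
  have e2 := le_log_factorial_div (n := n) (a := 2) (by norm_num) (by omega)
  have e3 := le_log_factorial_div (n := n) (a := 3) (by norm_num) (by omega)
  have e7 := le_log_factorial_div (n := n) (a := 7) (by norm_num) (by omega)
  have e43 := le_log_factorial_div (n := n) (a := 43) (by norm_num) (by omega)
  have e1806 := le_log_factorial_div (n := n) (a := 1806) (by norm_num) (by omega)
  push_cast at e2 e3 e7 e43 e1806
  have hl3 : 0 < Real.log 3 := Real.log_pos (by norm_num)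
  have h4 : Real.log (D (n / 1806)) ≤ n / 1806 * Real.log 3 := by
    have := Real.log_le_log (hDR _) (show (D (n / 1806) : ℝ) ≤ 3 ^ (n / 1806) by exact_mod_cast ih)
    rw [Real.log_pow] at this
    refine this.trans (mul_le_mul_of_nonneg_right ?_ hl3.le)
    exact_mod_cast Nat.cast_div_le (α := ℝ) (m := n) (n := 1806)
  have hn4 : (4000 : ℝ) ≤ n := by exact_mod_cast hn
  have hn0 : (0 : ℝ) < n := by linarith
  -- Tangent line of `log` at `4096 = 2 ^ 12`, near the threshold 4000. The linear terms cancel, and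
  -- the total error is `6 log n + 1`.
  have h5 : Real.log n ≤ 12 * Real.log 2 + (n / 4096 - 1) := by
    have := Real.log_le_sub_one_of_pos (show (0 : ℝ) < n / 4096 by positivity)
    rw [Real.log_div hn0.ne' (by norm_num), show (4096 : ℝ) = 2 ^ 12 by norm_num,
      Real.log_pow] at this
    push_cast at this
    norm_num at this ⊢
    linarith
  have h6 := Real.log_two_lt_d9
  have h7 := Real.log_two_gt_d9
  have h8 := mul_le_mul_of_nonneg_left log_gap hn0.le
  have h9 : (n : ℝ) * Real.log 2 ≥ n * 0.69 := mul_le_mul_of_nonneg_left (by linarith) hn0.le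
  have key : Real.log (D n) < n * Real.log 3 := by
    ring_nf at *
    linarith
  rw [← Real.log_pow] at key
  have := (Real.log_lt_log_iff (hDR n) (by positivity)).1 key
  exact_mod_cast this

theorem D_succ (n : ℕ) : D (n + 1) = (D n).lcm (n + 1) := by
  unfold D
  rw [← Finset.insert_Icc_right_eq_Icc_add_one (by omega), Finset.lcm_insert, id, lcm_comm]
  rfl

/-- Checks `lcm (d, N - k + 1, …, i) < 3 ^ i` for all `N - k < i ≤ N`. The match on the least
common multiple makes the accumulator evaluate to a literal at each step. -/
def lcmCheck (N : ℕ) : ℕ → ℕ → Bool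
  | 0, _ => true
  | k + 1, d =>
    match d.lcm (N - k) with
    | 0 => false
    | e + 1 => (e + 1).blt (3 ^ (N - k)) && lcmCheck N k (e + 1)

theorem D_lt_of_lcmCheck {N k : ℕ} (hk : k ≤ N) (h : lcmCheck N k (D (N - k)) = true) {i : ℕ}
    (hi : N - k < i) (hiN : i ≤ N) : D i < 3 ^ i := by
  induction k with
  | zero => omega
  | succ k ih =>
    have hD : (D (N - (k + 1))).lcm (N - k) = D (N - k) := by
      rw [show N - k = N - (k + 1) + 1 by omega, D_succ]
    obtain ⟨e, he⟩ := Nat.exists_eq_succ_of_ne_zero (Nat.lcmUpto_ne_zero (N - k))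
    replace he : D (N - k) = e + 1 := he
    rw [lcmCheck, hD, he, Bool.and_eq_true, ← he, Nat.blt_eq] at h
    rcases Nat.eq_or_lt_of_le (show N - k ≤ i by omega) with rfl | hi'
    · exact h.1
    · exact ih (by omega) h.2 hi'

theorem lcmCheck_4000 : lcmCheck 4000 4000 1 = true := by decide +kernel

theorem D_lt_three_pow {n : ℕ} (hn : 1 ≤ n) : D n < 3 ^ n := by
  induction n using Nat.strong_induction_on with
  | _ n ih =>
    rcases le_or_gt n 4000 with h | h
    · exact D_lt_of_lcmCheck le_rfl (by simpa [D] using lcmCheck_4000) (by omega) h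
    · exact D_lt_three_pow_of_large h.le (ih _ (by omega) (by omega)).le

/-! ### Partial fractions and the linear form in 1 and `ζ(3)`. -/

noncomputable section

/-- The rational function whose square is `R n`. -/
def rootR (n : ℕ) (t : ℝ) : ℝ :=
  (∏ j ∈ Finset.Icc 1 n, (t - j)) / ∏ j ∈ Finset.range (n + 1), (t + j)

/-- The residue of `rootR n` at `-k`. -/
def residue (n k : ℕ) : ℤ := (-1) ^ (n + k) * (n + k).choose k * n.choose k

/-- The rational part of `∑_{t ≥ 1} (1 / ((t + k) (t + l) ^ 2) + 1 / ((t + k) ^ 2 (t + l)))`,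
with the opposite sign. -/
def pairRat (k l : ℕ) : ℚ :=
  if k = l then 2 * ∑ i ∈ range k, 1 / ((i : ℚ) + 1) ^ 3
  else (∑ i ∈ range k, 1 / ((i : ℚ) + 1) ^ 2 - ∑ i ∈ range l, 1 / ((i : ℚ) + 1) ^ 2) / (l - k)

end

theorem R_eq_sq (n : ℕ) (t : ℝ) : R n t = rootR n t ^ 2 := rfl

theorem prod_range_sub_self (k : ℕ) :
    ∏ j ∈ range k, ((j : ℝ) - k) = (-1) ^ k * k ! := by
  induction k with
  | zero => simp
  | succ k ih =>
    rw [prod_range_succ']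
    have : ∏ j ∈ range k, (((j + 1 : ℕ) : ℝ) - (k + 1 : ℕ)) = ∏ j ∈ range k, ((j : ℝ) - k) :=
      prod_congr rfl fun j _ => by push_cast; ring
    rw [this, ih, Nat.factorial_succ]
    push_cast
    ring

theorem prod_erase_range_sub {n k : ℕ} (hk : k ≤ n) :
    ∏ j ∈ (range (n + 1)).erase k, ((j : ℝ) - k) = (-1) ^ k * k ! * (n - k)! := by
  induction n, hk using Nat.le_induction with
  | base =>
    rw [range_add_one, erase_insert (by simp), prod_range_sub_self]
    simp
  | succ n hk ih =>
    rw [range_add_one, erase_insert_of_ne (by omega), prod_insert (by simp), ih,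
      Nat.succ_sub hk, Nat.factorial_succ]
    push_cast [Nat.cast_sub hk]
    ring

theorem prod_Icc_neg_sub (n k : ℕ) :
    (∏ j ∈ Icc 1 n, (-(k : ℝ) - j)) * k ! = (-1) ^ n * (n + k)! := by
  induction n with
  | zero => simp
  | succ n ih =>
    rw [← Finset.insert_Icc_right_eq_Icc_add_one (by omega), prod_insert (by simp), mul_assoc, ih,
      show n + 1 + k = (n + k) + 1 by ring, Nat.factorial_succ]
    push_cast
    ring

/-- Lagrange interpolation of the numerator, of degree `n`, at the `n + 1` poles `0, -1, …, -n`. -/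
theorem rootR_eq_sum (n : ℕ) {t : ℝ} (ht : 0 < t) :
    rootR n t = ∑ k ∈ range (n + 1), residue n k / (t + k) := by
  classical
  let v : ℕ → ℝ := fun k => -(k : ℝ)
  let P : Polynomial ℝ := ∏ j ∈ Icc 1 n, (Polynomial.X - Polynomial.C (j : ℝ))
  have hv : Set.InjOn v (range (n + 1)) := fun a _ b _ h => by simpa [v] using h
  have hdeg : P.degree < #(range (n + 1)) := by
    rw [Polynomial.degree_prod]
    simp only [Polynomial.degree_X_sub_C, sum_const, card_range, Nat.card_Icc]
    simp only [nsmul_eq_mul, mul_one]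
    exact_mod_cast (by omega : n + 1 - 1 < n + 1)
  have hP := Lagrange.eq_interpolate (s := range (n + 1)) hv hdeg
  have hPe : ∀ x, P.eval x = ∏ j ∈ Icc 1 n, (x - j) := fun x => by
    simp [P, Polynomial.eval_prod]
  have hnode : ∀ k ∈ range (n + 1), t ≠ v k := fun k _ h => by
    have : (0 : ℝ) ≤ k := k.cast_nonneg
    simp only [v] at h; linarith
  have h := Lagrange.eval_interpolate_not_at_node (fun i => P.eval (v i)) hnode
  rw [← hP, Lagrange.eval_nodal, hPe] at h
  have hQ : ∏ j ∈ range (n + 1), (t - v j) = ∏ j ∈ range (n + 1), (t + j) :=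
    prod_congr rfl fun j _ => by simp [v]
  have hpos : 0 < ∏ j ∈ range (n + 1), (t + (j : ℝ)) := prod_pos fun j _ => by positivity
  rw [rootR, h, hQ, mul_div_cancel_left₀ _ hpos.ne']
  refine sum_congr rfl fun k hk => ?_
  have hk' : k ≤ n := by simpa [Nat.lt_succ_iff] using hk
  have hw : Lagrange.nodalWeight (range (n + 1)) v k = ((-1) ^ k * k ! * (n - k)! : ℝ)⁻¹ := by
    rw [Lagrange.nodalWeight, ← prod_erase_range_sub hk', ← prod_inv_distrib]
    exact prod_congr rfl fun j _ => by simp only [v]; ring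
  rw [hw, hPe]
  have h1 := prod_Icc_neg_sub n k
  have hkf : (k ! : ℝ) ≠ 0 := by exact_mod_cast k.factorial_ne_zero
  have hnkf : ((n - k)! : ℝ) ≠ 0 := by exact_mod_cast (n - k).factorial_ne_zero
  have hnf : (n ! : ℝ) ≠ 0 := by exact_mod_cast n.factorial_ne_zero
  rw [← eq_div_iff hkf] at h1
  have hc1 : ((n + k).choose k : ℝ) = (n + k)! / (n ! * k !) := by
    rw [Nat.choose_symm_add.symm, Nat.cast_add_choose]
  have hc2 : (n.choose k : ℝ) = n ! / (k ! * (n - k)!) := Nat.cast_choose ℝ hk'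
  have hr : (residue n k : ℝ) = (-1) ^ (n + k) * ((n + k)! / (n ! * k !)) *
      (n ! / (k ! * (n - k)!)) := by
    rw [residue]; push_cast; rw [hc1, hc2]
  have hv' : t - v k = t + k := by simp [v]
  have htk : t + (k : ℝ) ≠ 0 := by positivity
  have hsgn : ((-1 : ℝ) ^ k) * (-1) ^ k = 1 := by rw [← mul_pow]; simp
  rw [hv', hr, h1, pow_add]
  rw [show ((-1 : ℝ) ^ k) = ((-1) ^ k)⁻¹ from eq_inv_of_mul_eq_one_left hsgn]
  field_simp
  linear_combination hsgn

theorem hasDerivAt_rootR (n : ℕ) {t : ℝ} (ht : 0 < t) :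
    HasDerivAt (rootR n) (-∑ k ∈ range (n + 1), residue n k / (t + k) ^ 2) t := by
  have h : HasDerivAt (fun x : ℝ => ∑ k ∈ range (n + 1), (residue n k : ℝ) / (x + k))
      (∑ k ∈ range (n + 1), -((residue n k : ℝ) / (t + k) ^ 2)) t := by
    refine HasDerivAt.fun_sum fun k _ => ?_
    have htk : t + (k : ℝ) ≠ 0 := by positivity
    have := ((hasDerivAt_id' t).add_const (k : ℝ)).fun_inv htk |>.const_mul (residue n k : ℝ)
    simpa only [div_eq_mul_inv, neg_mul, one_mul, mul_neg] using this
  rw [← sum_neg_distrib]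
  refine h.congr_of_eventuallyEq ?_
  filter_upwards [lt_mem_nhds ht] with x hx using rootR_eq_sum n hx

theorem hasDerivAt_R (n : ℕ) {t : ℝ} (ht : 0 < t) :
    HasDerivAt (R n) (2 * rootR n t * deriv (rootR n) t) t := by
  have := (hasDerivAt_rootR n ht).differentiableAt.hasDerivAt.pow 2
  rw [show R n = rootR n ^ 2 from rfl]
  simpa using this

theorem neg_deriv_R_eq_sum (n : ℕ) {t : ℝ} (ht : 0 < t) :
    -deriv (R n) t = ∑ k ∈ range (n + 1), ∑ l ∈ range (n + 1), (residue n k * residue n l : ℝ) *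
      (1 / ((t + k) * (t + l) ^ 2) + 1 / ((t + k) ^ 2 * (t + l))) := by
  have h1 : ∀ k l : ℕ, (residue n k * residue n l : ℝ) *
      (1 / ((t + k) * (t + l) ^ 2) + 1 / ((t + k) ^ 2 * (t + l))) =
      (residue n k / (t + k)) * (residue n l / (t + l) ^ 2) +
      (residue n k / (t + k) ^ 2) * (residue n l / (t + l)) := fun k l => by
    have hk : t + (k : ℝ) ≠ 0 := by positivity
    have hl : t + (l : ℝ) ≠ 0 := by positivity
    field_simp
  simp only [h1, sum_add_distrib]
  rw [← sum_mul_sum, ← sum_mul_sum, (hasDerivAt_R n ht).deriv, (hasDerivAt_rootR n ht).deriv,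
    rootR_eq_sum n ht]
  ring

theorem hasSum_one_div_add_pow {s : ℕ} (hs : 1 < s) (k : ℕ) :
    HasSum (fun t : ℕ => 1 / ((t : ℝ) + 1 + k) ^ s)
      (∑' t : ℕ, 1 / ((t : ℝ) + 1) ^ s - ∑ i ∈ range k, 1 / ((i : ℝ) + 1) ^ s) := by
  have h : Summable fun t : ℕ => 1 / ((t : ℝ) + 1) ^ s := by
    have := (summable_nat_add_iff 1).2 (Real.summable_one_div_nat_pow.2 hs)
    simpa using this
  have := (hasSum_nat_add_iff' k).2 h.hasSum
  refine this.congr_fun fun t => ?_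
  push_cast
  ring

/-- For `k ≠ l` the summand is `(1 / (t + k) ^ 2 - 1 / (t + l) ^ 2) / (l - k)`, with `t` shifted by
1, so `ζ(2)` cancels and only the diagonal contributes `ζ(3)`. -/
theorem hasSum_pair (k l : ℕ) :
    HasSum (fun t : ℕ => 1 / (((t : ℝ) + 1 + k) * ((t : ℝ) + 1 + l) ^ 2) +
      1 / (((t : ℝ) + 1 + k) ^ 2 * ((t : ℝ) + 1 + l)))
      ((if k = l then 2 * zeta3 else 0) - (pairRat k l : ℝ)) := by
  rw [pairRat]
  split_ifs with h
  · subst h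
    have h1 := (hasSum_one_div_add_pow (s := 3) (by norm_num) k).mul_left 2
    rw [show 2 * zeta3 - ((2 * ∑ i ∈ range k, 1 / ((i : ℚ) + 1) ^ 3 : ℚ) : ℝ) =
      2 * (∑' t : ℕ, 1 / ((t : ℝ) + 1) ^ 3 - ∑ i ∈ range k, 1 / ((i : ℝ) + 1) ^ 3) by
        rw [zeta3]; push_cast; ring]
    refine h1.congr_fun fun t => ?_
    have h1 : (t : ℝ) + 1 + k ≠ 0 := by positivity
    field_simp
    norm_num
  · have hlk : (l : ℝ) - k ≠ 0 := sub_ne_zero.2 fun h' => h (by exact_mod_cast h'.symm)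
    have h1 := ((hasSum_one_div_add_pow (s := 2) (by norm_num) k).sub
      (hasSum_one_div_add_pow (s := 2) (by norm_num) l)).mul_left ((l : ℝ) - k)⁻¹
    rw [show (0 : ℝ) - (((∑ i ∈ range k, 1 / ((i : ℚ) + 1) ^ 2 -
        ∑ i ∈ range l, 1 / ((i : ℚ) + 1) ^ 2) / (l - k) : ℚ) : ℝ) = ((l : ℝ) - k)⁻¹ *
        (∑' t : ℕ, 1 / ((t : ℝ) + 1) ^ 2 - ∑ i ∈ range k, 1 / ((i : ℝ) + 1) ^ 2 -
        (∑' t : ℕ, 1 / ((t : ℝ) + 1) ^ 2 - ∑ i ∈ range l, 1 / ((i : ℝ) + 1) ^ 2)) by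
      push_cast; ring]
    refine h1.congr_fun fun t => ?_
    have h1 : (t : ℝ) + 1 + k ≠ 0 := by positivity
    have h2 : (t : ℝ) + 1 + l ≠ 0 := by positivity
    field_simp
    ring

theorem hasSum_neg_deriv_R (n : ℕ) :
    HasSum (fun t : ℕ => -deriv (R n) ((t : ℝ) + 1))
      (((2 * ∑ k ∈ range (n + 1), residue n k ^ 2 : ℤ) : ℝ) * zeta3 -
        ((∑ k ∈ range (n + 1), ∑ l ∈ range (n + 1), residue n k * residue n l * pairRat k l : ℚ) :
          ℝ)) := by
  have h : HasSum (fun t : ℕ => -deriv (R n) ((t : ℝ) + 1))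
      (∑ k ∈ range (n + 1), ∑ l ∈ range (n + 1), (residue n k * residue n l : ℝ) *
        ((if k = l then 2 * zeta3 else 0) - (pairRat k l : ℝ))) := by
    have h1 : (fun t : ℕ => -deriv (R n) ((t : ℝ) + 1)) = fun t : ℕ =>
        ∑ k ∈ range (n + 1), ∑ l ∈ range (n + 1), (residue n k * residue n l : ℝ) *
        (1 / (((t : ℝ) + 1 + k) * ((t : ℝ) + 1 + l) ^ 2) +
          1 / (((t : ℝ) + 1 + k) ^ 2 * ((t : ℝ) + 1 + l))) := by
      ext t; exact neg_deriv_R_eq_sum n (by positivity)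
    rw [h1]
    exact hasSum_sum fun k _ => hasSum_sum fun l _ => (hasSum_pair k l).mul_left _
  convert h using 1
  simp only [mul_sub, sum_sub_distrib, mul_ite, mul_zero]
  push_cast
  congr 1
  rw [mul_sum, sum_mul]
  refine sum_congr rfl fun k hk => ?_
  rw [sum_ite_eq, if_pos hk]
  ring

theorem D_ne_zero (n : ℕ) : D n ≠ 0 := Nat.lcmUpto_ne_zero n

theorem natCast_dvd_D {n m : ℕ} (h1 : 1 ≤ m) (h2 : m ≤ n) : m ∣ D n :=
  Finset.dvd_lcm (f := id) (Finset.mem_Icc.2 ⟨h1, h2⟩)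

theorem D_pow_mul_sum_mem {n k : ℕ} (hk : k ≤ n) (s : ℕ) :
    (D n : ℚ) ^ s * ∑ i ∈ range k, 1 / ((i : ℚ) + 1) ^ s ∈ (Int.castRingHom ℚ).range := by
  rw [mul_sum]
  refine Subring.sum_mem _ fun i hi => ?_
  have hi' : i + 1 ≤ n := by have := mem_range.1 hi; omega
  obtain ⟨c, hc⟩ := natCast_dvd_D (by omega) hi'
  refine ⟨(c : ℤ) ^ s, ?_⟩
  have : (i : ℚ) + 1 ≠ 0 := by positivity
  rw [hc]
  push_cast
  simp only [eq_intCast, Int.cast_pow, Int.cast_natCast]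
  field_simp
  rw [mul_pow, mul_comm]

theorem D_div_sub_mem {n k l : ℕ} (hk : k ≤ n) (hl : l ≤ n) (hkl : k ≠ l) :
    (D n : ℚ) / (l - k) ∈ (Int.castRingHom ℚ).range := by
  have h0 : (l : ℤ) - k ≠ 0 := fun h => hkl (by omega)
  have hd : ((l : ℤ) - k) ∣ (D n : ℤ) := by
    rw [← Int.natAbs_dvd_natAbs, Int.natAbs_natCast]
    exact natCast_dvd_D (by omega) (by omega)
  obtain ⟨c, hc⟩ := hd
  refine ⟨c, ?_⟩
  have h1 : (D n : ℚ) = ((l : ℚ) - k) * c := by exact_mod_cast hc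
  have h2 : (l : ℚ) - k ≠ 0 := by exact_mod_cast h0
  rw [h1, mul_div_cancel_left₀ _ h2]
  simp

/-- Off the diagonal, two factors `D n` clear the squares and the third clears `l - k`, of absolute
value at most `n`. -/
theorem D_pow_mul_pairRat_mem {n k l : ℕ} (hk : k ≤ n) (hl : l ≤ n) :
    (D n : ℚ) ^ 3 * pairRat k l ∈ (Int.castRingHom ℚ).range := by
  rw [pairRat]
  split_ifs with h
  · rw [mul_left_comm]
    exact Subring.mul_mem _ ⟨2, by simp⟩ (D_pow_mul_sum_mem hk 3)
  · have := Subring.mul_mem _ (D_div_sub_mem hk hl h)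
      (Subring.sub_mem _ (D_pow_mul_sum_mem hk 2) (D_pow_mul_sum_mem hl 2))
    convert this using 1
    ring

theorem exists_linear_form : ∃ (u : ℕ → ℤ) (v : ℕ → ℚ), ∀ n : ℕ,
    F n = (u n : ℝ) * zeta3 - (v n : ℝ) ∧ ∃ w : ℤ, (D n : ℚ) ^ 3 * v n = (w : ℚ) := by
  refine ⟨fun n => 2 * ∑ k ∈ range (n + 1), residue n k ^ 2, fun n => ∑ k ∈ range (n + 1),
    ∑ l ∈ range (n + 1), residue n k * residue n l * pairRat k l, fun n => ⟨?_, ?_⟩⟩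
  · rw [F, ← tsum_neg]
    exact (hasSum_neg_deriv_R n).tsum_eq
  · have : (D n : ℚ) ^ 3 * ∑ k ∈ range (n + 1), ∑ l ∈ range (n + 1),
        residue n k * residue n l * pairRat k l ∈ (Int.castRingHom ℚ).range := by
      simp only [mul_sum]
      refine Subring.sum_mem _ fun k hk => Subring.sum_mem _ fun l hl => ?_
      rw [mul_left_comm]
      refine Subring.mul_mem _ ⟨residue n k * residue n l, by simp⟩ (D_pow_mul_pairRat_mem ?_ ?_)
      · have := mem_range.1 hk; omega
      · have := mem_range.1 hl; omega
    obtain ⟨w, hw⟩ := this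
    exact ⟨w, by rw [← hw]; simp⟩

theorem summable_deriv_R (n : ℕ) : Summable fun t : ℕ => deriv (R n) ((t : ℝ) + 1) := by
  simpa using (hasSum_neg_deriv_R n).summable.neg

/-! ### Apéry's recurrence for `F` by creative telescoping. -/

theorem tsum_eq_neg_of_telescope {f g : ℕ → ℝ} (hf : Summable f)
    (h : ∀ t, f t = g (t + 1) - g t) (hg : Tendsto g atTop (𝓝 0)) : ∑' t, f t = -g 0 := by
  have h1 := hf.hasSum.tendsto_sum_nat
  simp only [h, sum_range_sub] at h1
  have h2 : Tendsto (fun n => g n - g 0) atTop (𝓝 (0 - g 0)) := hg.sub_const _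
  rw [zero_sub] at h2
  simpa [h] using tendsto_nhds_unique h1 h2

theorem prod_Icc_one_succ (f : ℕ → ℝ) (m : ℕ) :
    ∏ j ∈ Icc 1 (m + 1), f j = (∏ j ∈ Icc 1 m, f j) * f (m + 1) :=
  Finset.prod_Icc_succ_top (by omega) f

theorem prod_Icc_one_eq_range (f : ℕ → ℝ) (m : ℕ) :
    ∏ j ∈ Icc 1 m, f j = ∏ j ∈ range m, f (j + 1) := by
  induction m with
  | zero => simp
  | succ m ih => rw [prod_Icc_one_succ, ih, prod_range_succ]

theorem prod_sub_shift (m : ℕ) (t : ℝ) :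
    ∏ j ∈ Icc 1 (m + 1), (t + 1 - (j : ℝ)) = t * ∏ j ∈ Icc 1 m, (t - j) := by
  rw [prod_Icc_one_eq_range, prod_Icc_one_eq_range, prod_range_succ', mul_comm]
  congr 1
  · push_cast; ring
  · exact prod_congr rfl fun j _ => by push_cast; ring

theorem prod_add_shift (m : ℕ) (t : ℝ) :
    t * ∏ j ∈ range (m + 2), (t + 1 + (j : ℝ)) =
      (∏ j ∈ range (m + 1), (t + j)) * ((t + m + 1) * (t + m + 2)) := by
  have : t * ∏ j ∈ range (m + 2), (t + 1 + (j : ℝ)) = ∏ j ∈ range (m + 3), (t + (j : ℝ)) := by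
    rw [prod_range_succ' _ (m + 2), mul_comm]
    congr 1
    · exact prod_congr rfl fun j _ => by push_cast; ring
    · simp
  rw [this, prod_range_succ, prod_range_succ]
  push_cast
  ring

theorem rootR_succ (m : ℕ) (t : ℝ) :
    rootR (m + 1) t = rootR m t * ((t - (m + 1)) / (t + (m + 1))) := by
  rw [rootR, rootR, prod_Icc_one_succ, prod_range_succ, mul_div_mul_comm]
  push_cast
  rfl

theorem rootR_succ_shift (m : ℕ) {t : ℝ} (ht : 0 < t) :
    rootR (m + 1) (t + 1) = rootR m t * (t ^ 2 / ((t + m + 1) * (t + m + 2))) := by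
  have h := prod_add_shift m t
  have hQ : 0 < ∏ j ∈ range (m + 1), (t + (j : ℝ)) := prod_pos fun j _ => by positivity
  have hQ' : 0 < ∏ j ∈ range (m + 2), (t + 1 + (j : ℝ)) := prod_pos fun j _ => by positivity
  have h1 : 0 < (t + m + 1) * (t + m + 2) := by positivity
  rw [rootR, rootR, prod_sub_shift, _root_.div_mul_div_comm, div_eq_div_iff hQ'.ne' (by positivity), ← h]
  ring

noncomputable section

/-- The telescoping certificate for the recurrence satisfied by `R (m + 1)`. -/
def certR (m : ℕ) (t : ℝ) : ℝ :=
  4 * (2 * m + 3) * (-2 * t ^ 2 + t + (2 * m + 3) ^ 2) * R (m + 1) t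

/-- The derivative of `certR m` on the positive half-line. -/
def derivCertR (m : ℕ) (t : ℝ) : ℝ :=
  4 * (2 * m + 3) * (-4 * t + 1) * rootR (m + 1) t ^ 2 +
    4 * (2 * m + 3) * (-2 * t ^ 2 + t + (2 * m + 3) ^ 2) *
      (2 * rootR (m + 1) t * deriv (rootR (m + 1)) t)

/-- The sequence `X` satisfies Apéry's recurrence at all positive indices. -/
def AperyRec (X : ℕ → ℝ) : Prop :=
  ∀ m : ℕ, ((m : ℝ) + 2) ^ 3 * X (m + 2) -
    (2 * m + 3) * (17 * ((m : ℝ) + 1) ^ 2 + 17 * (m + 1) + 5) * X (m + 1) +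
    ((m : ℝ) + 1) ^ 3 * X m = 0

end

/-- Every term is an explicit rational multiple of `rootR m t ^ 2`, so a rational function identity
remains. -/
theorem R_recurrence (m : ℕ) {t : ℝ} (ht : 0 < t) :
    ((m : ℝ) + 2) ^ 3 * R (m + 2) t -
      (2 * m + 3) * (17 * ((m : ℝ) + 1) ^ 2 + 17 * (m + 1) + 5) * R (m + 1) t +
      ((m : ℝ) + 1) ^ 3 * R m t = certR m (t + 1) - certR m t := by
  rw [certR, certR, R_eq_sq, R_eq_sq, R_eq_sq, R_eq_sq, rootR_succ_shift m ht,
    rootR_succ (m + 1), rootR_succ m]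
  push_cast
  generalize rootR m t = q
  have h1 : t + m + 1 ≠ 0 := by positivity
  have h2 : t + m + 2 ≠ 0 := by positivity
  rw [show t + ((m : ℝ) + 1 + 1) = t + m + 2 by ring, show t + ((m : ℝ) + 1) = t + m + 1 by ring]
  field_simp
  ring

theorem hasDerivAt_certR (m : ℕ) {t : ℝ} (ht : 0 < t) :
    HasDerivAt (certR m) (derivCertR m t) t := by
  have h1 : HasDerivAt (fun t : ℝ => 4 * (2 * (m : ℝ) + 3) * (-2 * t ^ 2 + t + (2 * m + 3) ^ 2))
      (4 * (2 * m + 3) * (-4 * t + 1)) t := by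
    have := ((((hasDerivAt_pow 2 t).const_mul (-2)).add (hasDerivAt_id' t)).add_const
      ((2 * (m : ℝ) + 3) ^ 2)).const_mul (4 * (2 * (m : ℝ) + 3))
    exact this.congr_deriv (by push_cast; ring)
  exact h1.mul (hasDerivAt_R (m + 1) ht)

theorem deriv_R_recurrence (m : ℕ) {t : ℝ} (ht : 0 < t) :
    ((m : ℝ) + 2) ^ 3 * deriv (R (m + 2)) t -
      (2 * m + 3) * (17 * ((m : ℝ) + 1) ^ 2 + 17 * (m + 1) + 5) * deriv (R (m + 1)) t +
      ((m : ℝ) + 1) ^ 3 * deriv (R m) t = derivCertR m (t + 1) - derivCertR m t := by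
  have hd : ∀ n, HasDerivAt (R n) (deriv (R n) t) t := fun n =>
    (hasDerivAt_R n ht).differentiableAt.hasDerivAt
  have h1 := (((hd (m + 2)).const_mul (((m : ℝ) + 2) ^ 3)).sub ((hd (m + 1)).const_mul
    ((2 * m + 3) * (17 * ((m : ℝ) + 1) ^ 2 + 17 * (m + 1) + 5)))).add
    ((hd m).const_mul (((m : ℝ) + 1) ^ 3))
  have h2 := ((hasDerivAt_certR m (show 0 < t + 1 by linarith)).comp_add_const t 1).sub
    (hasDerivAt_certR m ht)
  refine h1.unique (h2.congr_of_eventuallyEq ?_)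
  filter_upwards [lt_mem_nhds ht] with x hx using R_recurrence m hx

theorem tendsto_div_add_const (k : ℝ) :
    Tendsto (fun t : ℝ => t / (t + k)) atTop (𝓝 1) := by
  have h : Tendsto (fun t : ℝ => 1 - k / (t + k)) atTop (𝓝 (1 - 0)) :=
    tendsto_const_nhds.sub
      (tendsto_const_nhds.div_atTop (tendsto_atTop_add_const_right _ k tendsto_id))
  rw [sub_zero] at h
  refine h.congr' ?_
  filter_upwards [eventually_gt_atTop (-k)] with t ht
  have : t + k ≠ 0 := by linarith
  field_simp
  ring

theorem tendsto_mul_rootR (n : ℕ) :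
    Tendsto (fun t : ℝ => t * rootR n t) atTop
      (𝓝 (∑ k ∈ range (n + 1), (residue n k : ℝ) * 1)) := by
  have h : Tendsto (fun t : ℝ => ∑ k ∈ range (n + 1), (residue n k : ℝ) * (t / (t + k))) atTop
      (𝓝 (∑ k ∈ range (n + 1), (residue n k : ℝ) * 1)) :=
    tendsto_finsetSum _ fun k _ => (tendsto_div_add_const k).const_mul _
  refine h.congr' ?_
  filter_upwards [eventually_gt_atTop 0] with t ht
  rw [rootR_eq_sum n ht, mul_sum]
  exact sum_congr rfl fun k _ => by ring

theorem tendsto_sq_mul_deriv_rootR (n : ℕ) :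
    Tendsto (fun t : ℝ => t ^ 2 * deriv (rootR n) t) atTop
      (𝓝 (-∑ k ∈ range (n + 1), (residue n k : ℝ) * 1 ^ 2)) := by
  have h : Tendsto (fun t : ℝ => -∑ k ∈ range (n + 1), (residue n k : ℝ) * (t / (t + k)) ^ 2) atTop
      (𝓝 (-∑ k ∈ range (n + 1), (residue n k : ℝ) * 1 ^ 2)) :=
    (tendsto_finsetSum _ fun (k : ℕ) _ => ((tendsto_div_add_const (k : ℝ)).pow 2).const_mul _).neg
  refine h.congr' ?_
  filter_upwards [eventually_gt_atTop 0] with t ht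
  rw [(hasDerivAt_rootR n ht).deriv, mul_neg, mul_sum]
  congr 1
  exact sum_congr rfl fun k _ => by rw [div_pow]; ring

/-- Since `rootR` is `O(1 / t)` and its derivative `O(1 / t ^ 2)`, both summands are `O(1 / t)`. -/
theorem tendsto_derivCertR (m : ℕ) : Tendsto (derivCertR m) atTop (𝓝 0) := by
  have hi : Tendsto (fun t : ℝ => t⁻¹) atTop (𝓝 0) := tendsto_inv_atTop_zero
  have hq := tendsto_mul_rootR (m + 1)
  have hq' := tendsto_sq_mul_deriv_rootR (m + 1)
  have h1 : Tendsto (fun t : ℝ => 4 * (2 * (m : ℝ) + 3) * (-4 + t⁻¹)) atTop _ :=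
    (hi.const_add (-4)).const_mul (4 * (2 * (m : ℝ) + 3))
  have h2 : Tendsto (fun t : ℝ => 4 * (2 * (m : ℝ) + 3) *
      (-2 + (t⁻¹ + (2 * m + 3) ^ 2 * (t⁻¹) ^ 2))) atTop _ :=
    ((hi.add ((hi.pow 2).const_mul ((2 * (m : ℝ) + 3) ^ 2))).const_add (-2)).const_mul
      (4 * (2 * (m : ℝ) + 3))
  have h := (((h1.mul (hq.pow 2)).add ((h2.mul (hq.mul hq')).const_mul 2)).mul hi)
  rw [mul_zero] at h
  refine h.congr' ?_
  filter_upwards [eventually_gt_atTop 0] with t ht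
  rw [derivCertR]
  field_simp
  ring

theorem rootR_succ_one (m : ℕ) : rootR (m + 1) 1 = 0 := by
  rw [rootR, prod_eq_zero (i := 1) (by simp) (by simp), zero_div]

theorem tendsto_natCast_add_one : Tendsto (fun t : ℕ => (t : ℝ) + 1) atTop atTop :=
  tendsto_atTop_add_const_right _ 1 tendsto_natCast_atTop_atTop

theorem aperyRec_F : AperyRec F := by
  intro m
  have s0 := summable_deriv_R m
  have s1 := summable_deriv_R (m + 1)
  have s2 := summable_deriv_R (m + 2)
  have hs := ((s2.mul_left (((m : ℝ) + 2) ^ 3)).sub (s1.mul_left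
    ((2 * m + 3) * (17 * ((m : ℝ) + 1) ^ 2 + 17 * (m + 1) + 5)))).add
    (s0.mul_left (((m : ℝ) + 1) ^ 3))
  have h := tsum_eq_neg_of_telescope (g := fun t : ℕ => derivCertR m ((t : ℝ) + 1)) hs
    (fun t => by
      rw [deriv_R_recurrence m (by positivity : (0 : ℝ) < (t : ℝ) + 1)]
      push_cast
      rfl)
    ((tendsto_derivCertR m).comp tendsto_natCast_add_one)
  rw [Summable.tsum_add ((s2.mul_left _).sub (s1.mul_left _)) (s0.mul_left _),
    Summable.tsum_sub (s2.mul_left _) (s1.mul_left _), tsum_mul_left, tsum_mul_left,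
    tsum_mul_left] at h
  -- Both summands of `derivCertR` contain `rootR (m + 1)`, which vanishes at 1; the recurrence is
  -- therefore homogeneous.
  simp only [derivCertR, Nat.cast_zero, zero_add, rootR_succ_one] at h
  simp only [F]
  linear_combination -h

/-! ### Ball's series: bounds and the same recurrence. -/

noncomputable section

/-- Ball's rational function without the factor `2 t + n`. -/
def ballCore (n : ℕ) (t : ℝ) : ℝ :=
  (n ! : ℝ) ^ 2 * ((∏ j ∈ Icc 1 n, (t - j)) * ∏ j ∈ Icc 1 n, (t + n + j)) /
    (∏ j ∈ range (n + 1), (t + j)) ^ 4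

/-- The numerator of the telescoping certificate for `ballR n`. -/
def ballNum (n t : ℝ) : ℝ :=
  -t ^ 6 - (8 * n - 1) * t ^ 5 + (4 * n ^ 2 + 27 * n + 5) * t ^ 4 +
    2 * n * (67 * n ^ 2 + 71 * n + 15) * t ^ 3 +
    (358 * n ^ 4 + 339 * n ^ 3 + 76 * n ^ 2 - 7 * n - 3) * t ^ 2 +
    (384 * n ^ 5 + 396 * n ^ 4 + 97 * n ^ 3 - 29 * n ^ 2 - 17 * n - 2) * t +
    n * (153 * n ^ 5 + 183 * n ^ 4 + 50 * n ^ 3 - 30 * n ^ 2 - 22 * n - 4)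

/-- The telescoping certificate for the recurrence satisfied by `ballR (m + 1)`. -/
def certBall (m : ℕ) (t : ℝ) : ℝ :=
  ballCore (m + 1) t * (ballNum (m + 1) t / ((t + 2 * m + 1) * (t + 2 * m + 2)))

end

theorem ballR_eq (n : ℕ) (t : ℝ) : ballR n t = (2 * t + n) * ballCore n t := by
  rw [ballR, ballCore]; ring

theorem ballCore_zero (t : ℝ) : ballCore 0 t = 1 / t ^ 4 := by
  simp [ballCore]

theorem prod_upper_succ (m : ℕ) (t : ℝ) :
    (t + m + 1) * ∏ j ∈ Icc 1 (m + 1), (t + (m + 1 : ℕ) + (j : ℝ)) =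
      (∏ j ∈ Icc 1 m, (t + m + j)) * ((t + 2 * m + 1) * (t + 2 * m + 2)) := by
  have : (t + m + 1) * ∏ j ∈ Icc 1 (m + 1), (t + (m + 1 : ℕ) + (j : ℝ)) =
      ∏ j ∈ Icc 1 (m + 2), (t + m + (j : ℝ)) := by
    rw [prod_Icc_one_eq_range, prod_Icc_one_eq_range, prod_range_succ' _ (m + 1), mul_comm]
    congr 1
    · exact prod_congr rfl fun j _ => by push_cast; ring
    · simp
  rw [this, prod_Icc_one_succ, prod_Icc_one_succ]
  push_cast
  ring

theorem ballCore_succ (m : ℕ) {t : ℝ} (ht : 0 < t) :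
    ballCore (m + 1) t = ballCore m t * ((m + 1) ^ 2 * (t - (m + 1)) *
      ((t + 2 * m + 1) * (t + 2 * m + 2)) / (t + m + 1) ^ 5) := by
  have hx : t + m + 1 ≠ 0 := by positivity
  have hQ : ∏ j ∈ range (m + 1), (t + (j : ℝ)) ≠ 0 :=
    (prod_pos fun j _ => by positivity).ne'
  have h : ∏ j ∈ Icc 1 (m + 1), (t + (m + 1 : ℕ) + (j : ℝ)) =
      (∏ j ∈ Icc 1 m, (t + m + j)) * ((t + 2 * m + 1) * (t + 2 * m + 2)) / (t + m + 1) := by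
    rw [← prod_upper_succ, mul_div_cancel_left₀ _ hx]
  rw [ballCore, ballCore, h, prod_Icc_one_succ, prod_range_succ _ (m + 1), Nat.factorial_succ]
  push_cast
  rw [← add_assoc t (m : ℝ) 1]
  field_simp

theorem ballCore_succ_shift (m : ℕ) {t : ℝ} (ht : 0 < t) :
    ballCore (m + 1) (t + 1) = ballCore m t * ((m + 1) ^ 2 * t ^ 5 *
      ((t + 2 * m + 1) * (t + 2 * m + 2) * (t + 2 * m + 3)) /
        ((t + m + 1) ^ 5 * (t + m + 2) ^ 5)) := by
  have hx : t + m + 1 ≠ 0 := by positivity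
  have hx2 : t + m + 2 ≠ 0 := by positivity
  have hQ : ∏ j ∈ range (m + 1), (t + (j : ℝ)) ≠ 0 :=
    (prod_pos fun j _ => by positivity).ne'
  have hC : ∏ j ∈ Icc 1 (m + 1), (t + 1 + (m + 1 : ℕ) + (j : ℝ)) =
      (∏ j ∈ Icc 1 m, (t + m + j)) * ((t + 2 * m + 1) * (t + 2 * m + 2) * (t + 2 * m + 3)) /
        ((t + m + 1) * (t + m + 2)) := by
    have h1 := prod_upper_succ m t
    have h2 : (t + m + 2) * ∏ j ∈ Icc 1 (m + 1), (t + 1 + (m + 1 : ℕ) + (j : ℝ)) =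
        (∏ j ∈ Icc 1 (m + 1), (t + (m + 1 : ℕ) + (j : ℝ))) * (t + 2 * m + 3) := by
      have : (t + m + 2) * ∏ j ∈ Icc 1 (m + 1), (t + 1 + (m + 1 : ℕ) + (j : ℝ)) =
          ∏ j ∈ Icc 1 (m + 2), (t + (m + 1 : ℕ) + (j : ℝ)) := by
        rw [prod_Icc_one_eq_range, prod_Icc_one_eq_range, prod_range_succ' _ (m + 1), mul_comm]
        congr 1
        · exact prod_congr rfl fun j _ => by push_cast; ring
        · push_cast; ring
      rw [this, prod_Icc_one_succ]
      push_cast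
      ring
    rw [eq_div_iff (mul_ne_zero hx hx2)]
    linear_combination (t + m + 1) * h2 + (t + 2 * m + 3) * h1
  have hQ' : ∏ j ∈ range (m + 2), (t + 1 + (j : ℝ)) =
      (∏ j ∈ range (m + 1), (t + j)) * ((t + m + 1) * (t + m + 2)) / t := by
    rw [← prod_add_shift, mul_div_cancel_left₀ _ ht.ne']
  rw [ballCore, ballCore, hC, hQ', prod_sub_shift, Nat.factorial_succ]
  push_cast
  field_simp

theorem ballR_recurrence (m : ℕ) {t : ℝ} (ht : 0 < t) :
    ((m : ℝ) + 2) ^ 3 * ballR (m + 2) t -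
      (2 * m + 3) * (17 * ((m : ℝ) + 1) ^ 2 + 17 * (m + 1) + 5) * ballR (m + 1) t +
      ((m : ℝ) + 1) ^ 3 * ballR m t = certBall m (t + 1) - certBall m t := by
  rw [certBall, certBall, ballR_eq, ballR_eq, ballR_eq, ballCore_succ_shift m ht,
    ballCore_succ (m + 1) ht, ballCore_succ m ht, ballNum, ballNum]
  push_cast
  generalize ballCore m t = q
  have hm : (0 : ℝ) ≤ m := m.cast_nonneg
  generalize (m : ℝ) = x at *
  have h1 : t + x + 1 ≠ 0 := by positivity
  have h2 : t + x + 2 ≠ 0 := by positivity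
  have h3 : t + 2 * x + 1 ≠ 0 := by positivity
  have h4 : t + 2 * x + 2 ≠ 0 := by positivity
  have h5 : t + 2 * x + 3 ≠ 0 := by positivity
  rw [show t + (x + 1) + 1 = t + x + 2 by ring, show t + 1 + 2 * x + 1 = t + 2 * x + 2 by ring,
    show t + 1 + 2 * x + 2 = t + 2 * x + 3 by ring]
  field_simp
  ring

/-- On `[n, ∞)` the core of Ball's function is at most its value for `n = 0`. -/
theorem ballCore_bounds (n : ℕ) {t : ℝ} (ht : 0 < t) (hnt : (n : ℝ) ≤ t) :
    0 ≤ ballCore n t ∧ ballCore n t ≤ 1 / t ^ 4 ∧ ((n : ℝ) < t → 0 < ballCore n t) ∧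
      (1 ≤ n → ballCore n t ≤ 2 * n / t ^ 5) := by
  induction n with
  | zero =>
    have : 0 < 1 / t ^ 4 := by positivity
    simp only [ballCore_zero]
    exact ⟨this.le, le_rfl, fun _ => this, by simp⟩
  | succ m ih =>
    push_cast at hnt ⊢
    have hm : (0 : ℝ) ≤ m := m.cast_nonneg
    obtain ⟨h0, h1, hp, -⟩ := ih (by linarith)
    rw [ballCore_succ m ht]
    set x := t + m + 1 with hx
    have hx0 : 0 < x := by positivity
    -- The ratio of consecutive cores is at most 1 because `m + 1 ≤ t`; keeping the factor `(m + 1)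
    -- / x` gains the extra power of `t` in the last bound.
    have hb : (m + 1 : ℝ) ^ 2 * (t - (m + 1)) * ((t + 2 * m + 1) * (t + 2 * m + 2)) / x ^ 5 ≤
        2 * ((m + 1) / x) := by
      rw [← mul_div_assoc, div_le_div_iff₀ (by positivity) hx0]
      have e1 : (m + 1 : ℝ) ≤ x / 2 := by linarith
      have e2 : t - (m + 1) ≤ x := by linarith
      have e3 : (t + 2 * m + 1) * (t + 2 * m + 2) ≤ (3 / 2 * x) * (3 / 2 * x) :=
        mul_le_mul (by linarith) (by linarith) (by positivity) (by positivity)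
      calc (m + 1 : ℝ) ^ 2 * (t - (m + 1)) * ((t + 2 * m + 1) * (t + 2 * m + 2)) * x
          = (m + 1) * ((m + 1) * (t - (m + 1)) * ((t + 2 * m + 1) * (t + 2 * m + 2))) * x := by
            ring
        _ ≤ (m + 1) * (x / 2 * x * ((3 / 2 * x) * (3 / 2 * x))) * x := by
            gcongr
        _ = (9 / 8 * (m + 1)) * x ^ 5 := by ring
        _ ≤ 2 * (m + 1) * x ^ 5 := by gcongr; norm_num
    have hr0 : 0 ≤ (m + 1 : ℝ) ^ 2 * (t - (m + 1)) * ((t + 2 * m + 1) * (t + 2 * m + 2)) /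
        x ^ 5 := by
      have : 0 ≤ t - (m + 1) := by linarith
      positivity
    have hmx : 2 * ((m + 1) / x) ≤ 1 := by
      rw [← mul_div_assoc, div_le_one hx0]; linarith
    have hmt : (m + 1) / x ≤ (m + 1) / t := by gcongr; linarith
    refine ⟨mul_nonneg h0 hr0, ?_, fun h => mul_pos (hp (by linarith)) ?_, fun _ => ?_⟩
    · exact (mul_le_of_le_one_right h0 (hb.trans hmx)).trans h1
    · have : 0 < t - (m + 1) := by linarith
      positivity
    · calc _ ≤ 1 / t ^ 4 * (2 * ((m + 1) / t)) :=
            mul_le_mul h1 (hb.trans (by linarith)) hr0 (by positivity)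
        _ = _ := by field_simp

theorem ballR_eq_zero {n t : ℕ} (h : t + 1 ≤ n) : ballR n ((t : ℝ) + 1) = 0 := by
  rw [ballR, prod_eq_zero (i := t + 1) (Finset.mem_Icc.2 ⟨by omega, h⟩) (by push_cast; ring)]
  simp

/-- The terms vanish up to the argument `n`; beyond it `2 t + n ≤ 3 t`. Uniformity in `n` is what
later makes `ballF` a bounded solution. -/
theorem ballR_nonneg_le (n t : ℕ) :
    0 ≤ ballR n ((t : ℝ) + 1) ∧ ballR n ((t : ℝ) + 1) ≤ 3 * (1 / ((t : ℝ) + 1) ^ 3) := by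
  rcases le_or_gt (t + 1) n with h | h
  · rw [ballR_eq_zero h]
    exact ⟨le_rfl, by positivity⟩
  · have ht : (0 : ℝ) < (t : ℝ) + 1 := by positivity
    have hn : (n : ℝ) ≤ (t : ℝ) + 1 := by exact_mod_cast h.le
    obtain ⟨h0, h1, -, -⟩ := ballCore_bounds n ht hn
    rw [ballR_eq]
    refine ⟨by positivity, ?_⟩
    calc _ ≤ (3 * ((t : ℝ) + 1)) * (1 / ((t : ℝ) + 1) ^ 4) :=
          mul_le_mul (by linarith) h1 h0 (by positivity)
      _ = _ := by field_simp

theorem summable_one_div_cube : Summable fun t : ℕ => 1 / ((t : ℝ) + 1) ^ 3 := by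
  simpa using (hasSum_one_div_add_pow (s := 3) (by norm_num) 0).summable

theorem summable_ballR (n : ℕ) : Summable fun t : ℕ => ballR n ((t : ℝ) + 1) :=
  Summable.of_nonneg_of_le (fun t => (ballR_nonneg_le n t).1) (fun t => (ballR_nonneg_le n t).2)
    (summable_one_div_cube.mul_left 3)

theorem ballF_le (n : ℕ) : ballF n ≤ 3 * zeta3 := by
  rw [ballF, zeta3, ← tsum_mul_left]
  exact (summable_ballR n).tsum_le_tsum (fun t => (ballR_nonneg_le n t).2)
    (summable_one_div_cube.mul_left 3)

theorem ballF_pos (n : ℕ) : 0 < ballF n := by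
  refine (summable_ballR n).tsum_pos (fun t => (ballR_nonneg_le n t).1) n ?_
  have h := (ballCore_bounds n (t := (n : ℝ) + 1) (by positivity) (by linarith)).2.2.1 (by linarith)
  rw [ballR_eq]
  positivity

theorem exists_abs_ballNum_le (n : ℝ) :
    ∃ K, 0 ≤ K ∧ ∀ t : ℝ, 1 ≤ t → |ballNum n t| ≤ K * t ^ 6 := by
  have mono : ∀ (a : ℝ) (i : ℕ) (_ : i ≤ 6) (t : ℝ), 1 ≤ t → |a * t ^ i| ≤ |a| * t ^ 6 := by
    intro a i hi t ht
    rw [abs_mul, abs_pow, abs_of_nonneg (by linarith : 0 ≤ t)]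
    gcongr
  let c : ℕ → ℝ := fun i => match i with
    | 0 => n * (153 * n ^ 5 + 183 * n ^ 4 + 50 * n ^ 3 - 30 * n ^ 2 - 22 * n - 4)
    | 1 => 384 * n ^ 5 + 396 * n ^ 4 + 97 * n ^ 3 - 29 * n ^ 2 - 17 * n - 2
    | 2 => 358 * n ^ 4 + 339 * n ^ 3 + 76 * n ^ 2 - 7 * n - 3
    | 3 => 2 * n * (67 * n ^ 2 + 71 * n + 15)
    | 4 => 4 * n ^ 2 + 27 * n + 5
    | 5 => -(8 * n - 1)
    | _ => -1
  refine ⟨∑ i ∈ range 7, |c i|, sum_nonneg fun _ _ => abs_nonneg _, fun t ht => ?_⟩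
  have h : ballNum n t = ∑ i ∈ range 7, c i * t ^ i := by
    simp only [sum_range_succ, sum_range_zero, c, ballNum]; ring
  rw [h, sum_mul]
  refine (abs_sum_le_sum_abs _ _).trans (sum_le_sum fun i hi => mono _ i ?_ t ht)
  have := mem_range.1 hi; omega

/-- The numerator has degree 6 and the denominator degree 2, so the bound `1 / t ^ 4` on the core
would not suffice; the bound of order `1 / t ^ 5` does. -/
theorem tendsto_certBall (m : ℕ) : Tendsto (certBall m) atTop (𝓝 0) := by
  obtain ⟨K, hK, h⟩ := exists_abs_ballNum_le (m + 1)
  have hlim : Tendsto (fun t : ℝ => 2 * ((m : ℝ) + 1) * K / t) atTop (𝓝 0) :=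
    tendsto_const_nhds.div_atTop tendsto_id
  refine squeeze_zero_norm' ?_ hlim
  filter_upwards [eventually_ge_atTop ((m : ℝ) + 1)] with t ht
  have hm : (0 : ℝ) ≤ m := m.cast_nonneg
  have ht0 : 0 < t := by linarith
  obtain ⟨h0, -, -, h1⟩ := ballCore_bounds (m + 1) ht0 (by exact_mod_cast ht)
  have h1 := h1 (by omega)
  push_cast at h1
  rw [certBall, Real.norm_eq_abs, abs_mul, abs_of_nonneg h0, abs_div,
    abs_of_pos (show 0 < (t + 2 * m + 1) * (t + 2 * m + 2) by positivity)]
  calc _ ≤ 2 * ((m : ℝ) + 1) / t ^ 5 * (K * t ^ 6 / (t * t)) := by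
        gcongr
        · exact h t (by linarith)
        · linarith
        · linarith
    _ = _ := by field_simp

theorem aperyRec_ballF : AperyRec ballF := by
  intro m
  have s0 := summable_ballR m
  have s1 := summable_ballR (m + 1)
  have s2 := summable_ballR (m + 2)
  have hs := ((s2.mul_left (((m : ℝ) + 2) ^ 3)).sub (s1.mul_left
    ((2 * m + 3) * (17 * ((m : ℝ) + 1) ^ 2 + 17 * (m + 1) + 5)))).add
    (s0.mul_left (((m : ℝ) + 1) ^ 3))
  have h := tsum_eq_neg_of_telescope (g := fun t : ℕ => certBall m ((t : ℝ) + 1)) hs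
    (fun t => by
      rw [ballR_recurrence m (by positivity : (0 : ℝ) < (t : ℝ) + 1)]
      push_cast
      rfl)
    ((tendsto_certBall m).comp tendsto_natCast_add_one)
  rw [Summable.tsum_add ((s2.mul_left _).sub (s1.mul_left _)) (s0.mul_left _),
    Summable.tsum_sub (s2.mul_left _) (s1.mul_left _), tsum_mul_left, tsum_mul_left,
    tsum_mul_left] at h
  have h1 : certBall m ((0 : ℕ) + 1) = 0 := by
    rw [certBall, ballCore, prod_eq_zero (i := 1) (by simp) (by simp)]
    simp
  rw [h1] at h
  simp only [ballF]
  linear_combination h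

/-! ### Equality of the two series and exponential decay. -/

theorem F_zero_eq : F 0 = ballF 0 := by
  rw [F, ballF, ← tsum_neg]
  refine tsum_congr fun t => ?_
  rw [neg_deriv_R_eq_sum 0 (by positivity), ballR_eq, ballCore_zero]
  have : (t : ℝ) + 1 ≠ 0 := by positivity
  simp [residue]
  field_simp
  norm_num

theorem F_one_eq : F 1 = ballF 1 := by
  have hs := (summable_deriv_R 1).neg.sub (summable_ballR 1)
  -- The two summands differ by a telescoping term whose primitive vanishes at `t = 0`, as `3 - 1 -
  -- 2 = 0`.
  have h := tsum_eq_neg_of_telescope (g := fun t : ℕ => 3 / ((t : ℝ) + 1) ^ 3 -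
    1 / ((t : ℝ) + 1) ^ 2 - 2 / ((t : ℝ) + 1) ^ 4) hs (fun t => ?_) ?_
  · rw [Summable.tsum_sub (summable_deriv_R 1).neg (summable_ballR 1), tsum_neg] at h
    norm_num at h
    rw [F, ballF]
    linarith
  · rw [neg_deriv_R_eq_sum 1 (by positivity), ballR]
    have h1 : (t : ℝ) + 1 ≠ 0 := by positivity
    have h2 : (t : ℝ) + 1 + 1 ≠ 0 := by positivity
    simp [sum_range_succ, prod_range_succ, residue]
    field_simp
    ring
  · have h0 := tendsto_natCast_add_one
    have h1 : ∀ (a : ℝ) (k : ℕ), k ≠ 0 →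
        Tendsto (fun t : ℕ => a / ((t : ℝ) + 1) ^ k) atTop (𝓝 0) := fun a k hk =>
      tendsto_const_nhds.div_atTop ((tendsto_pow_atTop hk).comp h0)
    simpa using ((h1 3 3 (by norm_num)).sub (h1 1 2 (by norm_num))).sub (h1 2 4 (by norm_num))

theorem AperyRec.eq_of_initial {X Y : ℕ → ℝ} (hX : AperyRec X) (hY : AperyRec Y)
    (h0 : X 0 = Y 0) (h1 : X 1 = Y 1) (n : ℕ) : X n = Y n := by
  induction n using Nat.twoStepInduction with
  | zero => exact h0
  | one => exact h1
  | more m ihm ihs =>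
    have h := hX m
    have h' := hY m
    rw [ihm, ihs] at h
    have hm : ((m : ℝ) + 2) ^ 3 ≠ 0 := by positivity
    exact mul_left_cancel₀ hm (by linear_combination h - h')

theorem F_eq_ballF (n : ℕ) : F n = ballF n :=
  aperyRec_F.eq_of_initial aperyRec_ballF F_zero_eq F_one_eq n

theorem sqrt_two_sub_one_pow_four : (√2 - 1) ^ 4 = 17 - 12 * √2 := by
  have h : √2 ^ 2 = 2 := Real.sq_sqrt (by norm_num)
  linear_combination (√2 ^ 2 - 4 * √2 + 8) * h

theorem sqrt_two_sub_one_pow_four_bounds :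
    0 < (√2 - 1) ^ 4 ∧ (√2 - 1) ^ 4 < (1 / 28 : ℝ) := by
  have h : (1.414 : ℝ) < √2 := by
    rw [Real.lt_sqrt (by norm_num)]; norm_num
  refine ⟨pow_pos (by linarith) 4, ?_⟩
  rw [sqrt_two_sub_one_pow_four]
  linarith

/-- A bounded positive solution of Apéry's recurrence decays at the rate of the recessive
solution. -/
theorem AperyRec.succ_le {X : ℕ → ℝ} (hX : AperyRec X) (hpos : ∀ n, 0 < X n) {C : ℝ}
    (hC : ∀ n, X n ≤ C) (n : ℕ) : X (n + 1) ≤ (√2 - 1) ^ 4 * X n := by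
  obtain ⟨ha0, ha1⟩ := sqrt_two_sub_one_pow_four_bounds
  have hquad : (34 - (√2 - 1) ^ 4) * (√2 - 1) ^ 4 = 1 := by
    have h : √2 ^ 2 = 2 := Real.sq_sqrt (by norm_num)
    rw [sqrt_two_sub_one_pow_four]
    linear_combination (-144 : ℝ) * h
  generalize (√2 - 1) ^ 4 = a at *
  by_contra! hn
  -- The excess over the decaying rate at least quadruples: `(m + 2) ^ 3 ≤ 8 (m + 1) ^ 3` and `34 -
  -- a ≥ 32 = 8 * 4`, while the `X (m + 1)` term in `hrec` only helps.
  have step : ∀ m, 0 < X (m + 1) - a * X m →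
      4 * (X (m + 1) - a * X m) ≤ X (m + 2) - a * X (m + 1) := by
    intro m hm
    have hm0 : (0 : ℝ) ≤ m := m.cast_nonneg
    have hrec : ((m : ℝ) + 2) ^ 3 * (X (m + 2) - a * X (m + 1)) =
        (51 * ((m : ℝ) + 1) ^ 2 + 27 * (m + 1) + 5 - a * (3 * ((m : ℝ) + 1) ^ 2 + 3 * (m + 1) + 1)) *
          X (m + 1) + ((m : ℝ) + 1) ^ 3 * (34 - a) * (X (m + 1) - a * X m) := by
      linear_combination hX m + ((m : ℝ) + 1) ^ 3 * X m * hquad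
    have hbr : 0 ≤ 51 * ((m : ℝ) + 1) ^ 2 + 27 * (m + 1) + 5 -
        a * (3 * ((m : ℝ) + 1) ^ 2 + 3 * (m + 1) + 1) := by
      have : a * (3 * ((m : ℝ) + 1) ^ 2 + 3 * (m + 1) + 1) ≤
          1 * (3 * ((m : ℝ) + 1) ^ 2 + 3 * (m + 1) + 1) := by gcongr; linarith
      nlinarith
    have hcube : ((m : ℝ) + 2) ^ 3 ≤ (2 * (m + 1)) ^ 3 := by gcongr; linarith
    have hc : ((m : ℝ) + 2) ^ 3 * 4 ≤ ((m : ℝ) + 1) ^ 3 * (34 - a) := by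
      have : ((m : ℝ) + 1) ^ 3 * 32 ≤ ((m : ℝ) + 1) ^ 3 * (34 - a) := by gcongr; linarith
      nlinarith
    refine le_of_mul_le_mul_left ?_ (by positivity : 0 < ((m : ℝ) + 2) ^ 3)
    rw [hrec]
    nlinarith [mul_nonneg hbr (hpos (m + 1)).le, mul_le_mul_of_nonneg_right hc hm.le]
  have grow : ∀ k : ℕ, 4 ^ k * (X (n + 1) - a * X n) ≤ X (n + k + 1) - a * X (n + k) := by
    intro k
    induction k with
    | zero => simp
    | succ k ih =>
      have h0 : 0 < X (n + k + 1) - a * X (n + k) :=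
        lt_of_lt_of_le (mul_pos (by positivity) (by linarith)) ih
      have := step (n + k) h0
      rw [pow_succ]
      show _ ≤ X (n + k + 2) - a * X (n + k + 1)
      linarith
  obtain ⟨k, hk⟩ := pow_unbounded_of_one_lt (C / (X (n + 1) - a * X n)) (by norm_num : (1 : ℝ) < 4)
  rw [div_lt_iff₀ (by linarith)] at hk
  have h1 := grow k
  have h2 := hC (n + k + 1)
  have h3 := mul_pos ha0 (hpos (n + k))
  linarith

theorem zeta3_lt_two : zeta3 < 2 := by
  have h1 := hasSum_zeta_two
  have h2 := (hasSum_nat_add_iff' 1).2 h1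
  simp only [sum_range_one, Nat.cast_zero, ne_eq, OfNat.ofNat_ne_zero, not_false_eq_true, zero_pow,
    div_zero, sub_zero] at h2
  have h3 : zeta3 ≤ Real.pi ^ 2 / 6 := by
    rw [zeta3, ← h2.tsum_eq]
    refine summable_one_div_cube.tsum_le_tsum (fun t => ?_) h2.summable
    push_cast
    have : (1 : ℝ) ≤ (t : ℝ) + 1 := by simp
    exact one_div_le_one_div_of_le (by positivity) (pow_le_pow_right₀ this (by norm_num))
  have := Real.pi_lt_d2
  have := Real.pi_pos
  nlinarith

theorem ballF_lt (n : ℕ) : ballF n < 20 * (√2 - 1) ^ (4 * n) := by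
  have h : ballF n ≤ ballF 0 * ((√2 - 1) ^ 4) ^ n := by
    induction n with
    | zero => simp
    | succ n ih =>
      have h1 := aperyRec_ballF.succ_le ballF_pos ballF_le n
      have h2 := mul_le_mul_of_nonneg_left ih sqrt_two_sub_one_pow_four_bounds.1.le
      rw [pow_succ]
      linarith
  rw [pow_mul]
  refine h.trans_lt (mul_lt_mul_of_pos_right ?_ (pow_pos sqrt_two_sub_one_pow_four_bounds.1 n))
  have := ballF_le 0
  have := zeta3_lt_two
  linarith

theorem ballF_lt_quartic (n : ℕ) :
    ballF n < 20 * ((n : ℝ) + 1) ^ 4 * (√2 - 1) ^ (4 * n) := by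
  refine (ballF_lt n).trans_le ?_
  have h1 : (0 : ℝ) ≤ (√2 - 1) ^ (4 * n) := by
    rw [pow_mul]; exact (pow_pos sqrt_two_sub_one_pow_four_bounds.1 n).le
  have h2 : (1 : ℝ) ≤ ((n : ℝ) + 1) ^ 4 :=
    one_le_pow₀ (by simp)
  refine mul_le_mul_of_nonneg_right ?_ h1
  linarith

/-! ### Irrationality. -/

theorem irrational_zeta3 : Irrational zeta3 := by
  rintro ⟨q, hq⟩
  obtain ⟨u, v, huv⟩ := exists_linear_form
  have hden : (0 : ℝ) < q.den := by exact_mod_cast q.den_pos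
  have hlow : ∀ n, 1 ≤ (q.den : ℝ) * ((D n : ℝ) ^ 3 * ballF n) := by
    intro n
    obtain ⟨hF, w, hw⟩ := huv n
    have hD : (0 : ℝ) < D n := by exact_mod_cast Nat.pos_of_ne_zero (D_ne_zero n)
    have hw' : (D n : ℝ) ^ 3 * (v n : ℝ) = w := by exact_mod_cast congrArg (Rat.cast : ℚ → ℝ) hw
    have hz : (q.den : ℝ) * zeta3 = q.num := by
      rw [← hq]; exact_mod_cast congrArg (Rat.cast : ℚ → ℝ) (Rat.den_mul_eq_num q)
    have hint : (q.den : ℝ) * ((D n : ℝ) ^ 3 * ballF n) =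
        (((D n : ℤ) ^ 3 * u n * q.num - q.den * w : ℤ) : ℝ) := by
      rw [← F_eq_ballF, hF]
      push_cast
      linear_combination (D n : ℝ) ^ 3 * u n * hz - q.den * hw'
    have hp : 0 < (q.den : ℝ) * ((D n : ℝ) ^ 3 * ballF n) := by
      have := ballF_pos n
      positivity
    rw [hint] at hp ⊢
    exact_mod_cast (by exact_mod_cast hp :
      (0 : ℤ) < (D n : ℤ) ^ 3 * u n * q.num - q.den * w)
  obtain ⟨ha0, ha1⟩ := sqrt_two_sub_one_pow_four_bounds
  have hup : ∀ n, (D n : ℝ) ^ 3 * ballF n ≤ 20 * (27 * (√2 - 1) ^ 4) ^ n := by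
    intro n
    have hD : D n ≤ 3 ^ n := by
      rcases Nat.eq_zero_or_pos n with rfl | hn
      · simp [D]
      · exact (D_lt_three_pow hn).le
    have hD' : (D n : ℝ) ≤ 3 ^ n := by exact_mod_cast hD
    calc (D n : ℝ) ^ 3 * ballF n ≤ (3 ^ n) ^ 3 * (20 * (√2 - 1) ^ (4 * n)) := by
          have := (ballF_pos n).le
          have := (ballF_lt n).le
          gcongr
      _ = 20 * (27 * (√2 - 1) ^ 4) ^ n := by
          rw [pow_mul (√2 - 1), mul_pow, show (27 : ℝ) = 3 ^ 3 by norm_num, ← pow_mul, ← pow_mul 3 3,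
            mul_comm n 3]
          ring
  -- The bound `(√2 - 1) ^ 4 < 1 / 28` was chosen to beat the 27 coming from `(3 ^ n) ^ 3`.
  obtain ⟨n, hn⟩ := exists_pow_lt_of_lt_one (show 0 < 1 / ((q.den : ℝ) * 20) by positivity)
    (show 27 * (√2 - 1) ^ 4 < 1 by linarith)
  rw [lt_div_iff₀ (by positivity)] at hn
  have := mul_le_mul_of_nonneg_left (hup n) hden.le
  have := hlow n
  linarith

end AperyZetaThree

theorem mainTheorem1 :
    Irrational AperyZetaThree.zeta3 ∧
    (∀ n : ℕ, Summable fun t : ℕ => deriv (AperyZetaThree.R n) ((t : ℝ) + 1)) ∧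
    (∃ (u : ℕ → ℤ) (v : ℕ → ℚ), ∀ n : ℕ,
      AperyZetaThree.F n = (u n : ℝ) * AperyZetaThree.zeta3 - (v n : ℝ) ∧
      ∃ w : ℤ, (AperyZetaThree.D n : ℚ) ^ 3 * v n = (w : ℚ)) ∧
    (∀ n : ℕ, Summable fun t : ℕ => AperyZetaThree.ballR n ((t : ℝ) + 1)) ∧
    (∀ n : ℕ, AperyZetaThree.F n = AperyZetaThree.ballF n) ∧
    (∀ n : ℕ, 0 < AperyZetaThree.ballF n ∧
      AperyZetaThree.ballF n < 20 * ((n : ℝ) + 1) ^ 4 * (Real.sqrt 2 - 1) ^ (4 * n)) ∧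
    (∀ n : ℕ, 1 ≤ n → AperyZetaThree.D n < 3 ^ n) :=
  ⟨AperyZetaThree.irrational_zeta3, AperyZetaThree.summable_deriv_R,
    AperyZetaThree.exists_linear_form, AperyZetaThree.summable_ballR, AperyZetaThree.F_eq_ballF,
    fun n => ⟨AperyZetaThree.ballF_pos n, AperyZetaThree.ballF_lt_quartic n⟩,
    fun _ hn => AperyZetaThree.D_lt_three_pow hn⟩
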